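/- Let $F:\mathbb R^n\rightrightarrows\mathbb R^n$ be a multifunction and $\mathcal K\subset\mathbb R^n$ a closed set (the target). Assume: (F) each $F(x)$ is nonempty, convex and compact; for every compact $C\subset\mathbb R^n$ there is $L>0$ with $F(x)\subset F(y)+L|y-x|\bar{\mathbb B}$ for all $x,y\in C$, where $\bar{\mathbb B}$ is the closed unit ball; there is $\gamma>0$ with $\max\{|v|:v\in F(x)\}\le\gamma(1+|x|)$ for all $x$. Put $H(x,p)=\max_{v\in F(x)}\langle v,p\rangle$ and $h(x,\zeta)=\min_{v\in F(x)}\langle v,\zeta\rangle$. Assume: (H) for every $r>0$: (H1) there is $c\ge 0$ such that for every $|p|=1$ the function $H(\cdot,p)$ is semiconvex on the ball $B(0,r)$ with constant $c$, i.e. it is continuous there and $H(x+k,p)+H(x-k,p)-2H(x,p)\ge -c|k|^2$ whenever $[x-k,x+k]\subset B(0,r)$; (H2) $\nabla_pH(x,p)$ exists for all $x\in B(0,r)$, $p\neq 0$, and is Lipschitz in $x$ on $B(0,r)$ with a constant independent of $p\ne 0$. A trajectory of $F$ on $[0,\tau]$ is an absolutely continuous $x:[0,\tau]\to\mathbb R^n$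 with $\dot x(t)\in F(x(t))$ for a.e. $t\in[0,\tau]$. Let $\mathcal T:\mathbb R^n\to[0,+\infty]$ be the minimum time function: $\mathcal T(x)=0$ if $x\in\mathcal K$, and for $x\notin\mathcal K$, $\mathcal T(x)$ is the infimum of all $\tau>0$ for which some trajectory of $F$ on $[0,\tau]$ satisfies $x(0)=x$ and $x(\tau)\in\mathcal K$ ($\inf\emptyset=+\infty$). For a set $S$ in a Euclidean space and $z\in S$, $N^P_S(z)$ is the set of vectors $v$ for which there is $\sigma\ge0$ with $\langle v,y-z\rangle\le\sigma|y-z|^2$ for all $y\in S$. With $\mathrm{epi}(\mathcal T)=\{(x,\beta)\in\mathbb R^n\times\mathbb R:\mathcal T(x)\le\beta\}$ and $\mathcal T(x)<+\infty$, the proximal subdifferential is $\partial^P\mathcal T(x)=\{v\in\mathbb R^n:(v,-1)\in N^P_{\mathrm{epi}(\mathcal T)}(x,\mathcal T(x))\}$; it is empty if $\mathcal T(x)=+\infty$. Let $\partial_xH(x,p)$ be the Clarke generalized gradient of $H(\cdot,p)$ at $x$, i.e. the convex hull of all limits of $\nabla_xH(y_i,p)$ along sequences $y_i\to x$ of points of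 differentiability of $H(\cdot,p)$. Let $x_0\notin\mathcal K$ with $\mathcal T(x_0)<+\infty$, and let $\bar x:[0,\mathcal T(x_0)]\to\mathbb R^n$ be an optimal trajectory for $x_0$, i.e. a trajectory of $F$ with $\bar x(0)=x_0$ and $\bar x(\mathcal T(x_0))\in\mathcal K$. Let $\bar p:[0,\mathcal T(x_0)]\to\mathbb R^n$ be absolutely continuous with $$\dot{\bar x}(s)=\nabla_pH(\bar x(s),\bar p(s)),\qquad -\dot{\bar p}(s)\in\partial_xH(\bar x(s),\bar p(s))\qquad\text{for a.e. } s\in[0,\mathcal T(x_0)],$$ and $-\bar p(0)\in\partial^P\mathcal T(x_0)$. Then, for all $t\in[0,\mathcal T(x_0)]$ (terminal time included), $$-\bar p(t)\in\partial^P\mathcal T(\bar x(t))\qquad\text{and}\qquad h(\bar x(t),-\bar p(t))=-1.$$ -/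

import Mathlib

open Set Filter Topology MeasureTheory
open scoped ENNReal Pointwise

noncomputable section

namespace MinTime

/-! ### Nonsmooth analysis -/

section Nonsmooth

variable {E : Type*} [NormedAddCommGroup E] [InnerProductSpace ℝ E]

/-- The proximal normal cone to `K` at the point `x` of `K`. -/
def proximalNormalCone (K : Set E) (x : E) : Set E :=
  {v | x ∈ K ∧ ∃ σ : ℝ, 0 ≤ σ ∧ ∀ y ∈ K, inner ℝ v (y - x) ≤ σ * ‖y - x‖ ^ 2}

/-- The epigraph of an extended real valued function, as a subset of the Hilbert product of the
space with the real line. -/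
def epigraph (f : E → EReal) : Set (WithLp 2 (E × ℝ)) :=
  {z | f z.fst ≤ (z.snd : EReal)}

/-- The proximal subdifferential of `f` at `x`: all `v` such that `(v, -1)` is a proximal normal
to the epigraph of `f` at `(x, f x)`. It is empty when `f x` is not finite. -/
def proximalSubdifferential (f : E → EReal) (x : E) : Set E :=
  {v | ∃ r : ℝ, f x = (r : EReal) ∧
    WithLp.toLp 2 (v, (-1 : ℝ)) ∈
      proximalNormalCone (epigraph f) (WithLp.toLp 2 (x, r))}

/-- Semiconcavity on `Ω` with semiconcavity constant `c`. -/
def SemiconcaveOn (Ω : Set E) (c : ℝ) (f : E → ℝ) : Prop :=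
  ContinuousOn f Ω ∧
    ∀ x k : E, segment ℝ (x - k) (x + k) ⊆ Ω →
      f (x + k) + f (x - k) - 2 * f x ≤ c * ‖k‖ ^ 2

/-- Semiconvexity on `Ω` with semiconvexity constant `c`. -/
def SemiconvexOn (Ω : Set E) (c : ℝ) (f : E → ℝ) : Prop :=
  SemiconcaveOn Ω c (fun x => -f x)

/-- Clarke's generalized gradient of (a locally Lipschitz function) `f` at `x`: the convex hull
of all limits of gradients of `f` along sequences of points of differentiability tending
to `x`. -/
def clarkeGradient [CompleteSpace E] (f : E → ℝ) (x : E) : Set E :=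
  convexHull ℝ {v | ∃ y : ℕ → E, (∀ i, DifferentiableAt ℝ f (y i)) ∧
    Tendsto y atTop (𝓝 x) ∧ Tendsto (fun i => gradient f (y i)) atTop (𝓝 v)}

end Nonsmooth

/-! ### The differential inclusion and the minimum time function -/

section Dynamics

variable {n : ℕ}

/-- The standing assumption on the multifunction: nonempty convex compact values, local
Lipschitz continuity, linear growth. -/
structure AssumptionF (F : EuclideanSpace ℝ (Fin n) → Set (EuclideanSpace ℝ (Fin n))) :
    Prop where
  nonempty : ∀ x, (F x).Nonempty
  convex : ∀ x, Convex ℝ (F x)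
  isCompact : ∀ x, IsCompact (F x)
  locallyLipschitz : ∀ K : Set (EuclideanSpace ℝ (Fin n)), IsCompact K →
    ∃ L : ℝ, 0 < L ∧ ∀ x ∈ K, ∀ y ∈ K,
      F x ⊆ F y + Metric.closedBall 0 (L * ‖y - x‖)
  linearGrowth : ∃ γ : ℝ, 0 < γ ∧ ∀ x, ∀ v ∈ F x, ‖v‖ ≤ γ * (1 + ‖x‖)

/-- The maximized Hamiltonian `H(x,p) = max_{v ∈ F x} ⟨v, p⟩` (a maximum when `F x` is
nonempty and compact). -/
def maxHamiltonian (F : EuclideanSpace ℝ (Fin n) → Set (EuclideanSpace ℝ (Fin n)))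
    (x p : EuclideanSpace ℝ (Fin n)) : ℝ :=
  sSup ((fun v => inner ℝ v p) '' F x)

/-- The minimized Hamiltonian `h(x,ζ) = min_{v ∈ F x} ⟨v, ζ⟩` (a minimum when `F x` is
nonempty and compact). -/
def minHamiltonian (F : EuclideanSpace ℝ (Fin n) → Set (EuclideanSpace ℝ (Fin n)))
    (x ζ : EuclideanSpace ℝ (Fin n)) : ℝ :=
  sInf ((fun v => inner ℝ v ζ) '' F x)

/-- The assumption on the maximized Hamiltonian, on every ball `B(0,r)`: semiconvexity in `x`
with a constant uniform over unit vectors `p`; differentiability in `p ≠ 0`, with a gradient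
`∇_p H(·,p)` which is Lipschitz with a constant uniform over `p ≠ 0`. -/
structure AssumptionH (F : EuclideanSpace ℝ (Fin n) → Set (EuclideanSpace ℝ (Fin n))) :
    Prop where
  semiconvex : ∀ r : ℝ, 0 < r → ∃ c : ℝ, 0 ≤ c ∧
    ∀ p : EuclideanSpace ℝ (Fin n), ‖p‖ = 1 →
      SemiconvexOn (Metric.ball 0 r) c (fun x => maxHamiltonian F x p)
  differentiable : ∀ r : ℝ, 0 < r →
    ∀ x ∈ Metric.ball (0 : EuclideanSpace ℝ (Fin n)) r, ∀ p : EuclideanSpace ℝ (Fin n),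
      p ≠ 0 → DifferentiableAt ℝ (maxHamiltonian F x) p
  gradientLipschitz : ∀ r : ℝ, 0 < r → ∃ L : ℝ, 0 ≤ L ∧
    ∀ p : EuclideanSpace ℝ (Fin n), p ≠ 0 →
      ∀ x ∈ Metric.ball (0 : EuclideanSpace ℝ (Fin n)) r,
      ∀ y ∈ Metric.ball (0 : EuclideanSpace ℝ (Fin n)) r,
        ‖gradient (maxHamiltonian F x) p - gradient (maxHamiltonian F y) p‖ ≤ L * ‖x - y‖

/-- `x` is a trajectory of `F` on `[0,τ]` starting at `x₀`: it is absolutely continuous, with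
`x 0 = x₀` and `x'(t) ∈ F (x t)` for almost every `t ∈ [0,τ]`. -/
structure IsTrajectory (F : EuclideanSpace ℝ (Fin n) → Set (EuclideanSpace ℝ (Fin n)))
    (x₀ : EuclideanSpace ℝ (Fin n)) (τ : ℝ) (x : ℝ → EuclideanSpace ℝ (Fin n)) : Prop where
  absolutelyContinuous : AbsolutelyContinuousOnInterval x 0 τ
  initial : x 0 = x₀
  inclusion : ∀ᵐ t ∂(volume.restrict (Icc 0 τ)), ∃ v ∈ F (x t), HasDerivAt x v t

open Classical in
/-- The minimum time function with target `K`, with values in `[0,∞]`. -/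
def minTime (F : EuclideanSpace ℝ (Fin n) → Set (EuclideanSpace ℝ (Fin n)))
    (K : Set (EuclideanSpace ℝ (Fin n))) (x₀ : EuclideanSpace ℝ (Fin n)) : ℝ≥0∞ :=
  if x₀ ∈ K then 0
  else sInf (ENNReal.ofReal ''
    {τ : ℝ | 0 < τ ∧ ∃ x : ℝ → EuclideanSpace ℝ (Fin n), IsTrajectory F x₀ τ x ∧ x τ ∈ K})

/-- `x` is an optimal trajectory for `x₀`: it starts at `x₀` and is on the target at
the (finite) minimum time. -/
def IsOptimalTrajectory (F : EuclideanSpace ℝ (Fin n) → Set (EuclideanSpace ℝ (Fin n)))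
    (K : Set (EuclideanSpace ℝ (Fin n))) (x₀ : EuclideanSpace ℝ (Fin n))
    (x : ℝ → EuclideanSpace ℝ (Fin n)) : Prop :=
  minTime F K x₀ ≠ ⊤ ∧ IsTrajectory F x₀ (minTime F K x₀).toReal x ∧
    x (minTime F K x₀).toReal ∈ K

/-- `(x,p)` is a solution on `[0,τ]` of the Hamiltonian inclusion
`x'(s) = ∇_p H(x(s),p(s))`, `-p'(s) ∈ ∂_x H(x(s),p(s))` for a.e. `s`, with `x`, `p`
absolutely continuous. -/
structure SolvesHamiltonianInclusion
    (F : EuclideanSpace ℝ (Fin n) → Set (EuclideanSpace ℝ (Fin n))) (τ : ℝ)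
    (x p : ℝ → EuclideanSpace ℝ (Fin n)) : Prop where
  absolutelyContinuous_state : AbsolutelyContinuousOnInterval x 0 τ
  absolutelyContinuous_arc : AbsolutelyContinuousOnInterval p 0 τ
  state_equation : ∀ᵐ s ∂(volume.restrict (Icc 0 τ)), ∃ v : EuclideanSpace ℝ (Fin n),
    HasGradientAt (maxHamiltonian F (x s)) v (p s) ∧ HasDerivAt x v s
  adjoint_inclusion : ∀ᵐ s ∂(volume.restrict (Icc 0 τ)), ∃ w : EuclideanSpace ℝ (Fin n),
    HasDerivAt p w s ∧ -w ∈ clarkeGradient (fun y => maxHamiltonian F y (p s)) (x s)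

end Dynamics

end MinTime

end

noncomputable section

namespace MinTime

section AbsoluteContinuity

variable {n : ℕ}

/-- An absolutely continuous real function with nonnegative derivative almost everywhere does
not decrease. -/
theorem le_of_ae_deriv_nonneg {f : ℝ → ℝ} {a b : ℝ} (hab : a ≤ b)
    (hf : AbsolutelyContinuousOnInterval f a b)
    (h : ∀ᵐ s ∂(volume.restrict (Icc a b)), ∃ v : ℝ, HasDerivAt f v s ∧ 0 ≤ v) :
    f a ≤ f b := by
  have h1 := hf.integral_deriv_eq_sub
  have h2 : 0 ≤ ∫ s in a..b, deriv f s := by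
    rw [intervalIntegral.integral_of_le hab, ← integral_Icc_eq_integral_Ioc]
    apply integral_nonneg_of_ae
    filter_upwards [h] with s hs
    obtain ⟨v, hv, hv0⟩ := hs
    simpa [hv.deriv] using hv0
  linarith

theorem _root_.LipschitzWith.comp_absolutelyContinuousOnInterval {X Y : Type*}
    [PseudoMetricSpace X] [PseudoMetricSpace Y] {g : X → Y} {C : NNReal} (hg : LipschitzWith C g)
    {f : ℝ → X} {a b : ℝ} (hf : AbsolutelyContinuousOnInterval f a b) :
    AbsolutelyContinuousOnInterval (fun s => g (f s)) a b := by
  refine squeeze_zero (fun t => Finset.sum_nonneg fun i _ => dist_nonneg) (fun t => ?_)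
    (by simpa using Tendsto.const_mul (C : ℝ) hf)
  rw [Finset.mul_sum]
  exact Finset.sum_le_sum fun i _ => hg.dist_le_mul _ _

theorem _root_.AbsolutelyContinuousOnInterval.const {X : Type*} [PseudoMetricSpace X] (c : X)
    (a b : ℝ) : AbsolutelyContinuousOnInterval (fun _ => c) a b :=
  (LipschitzWith.const c).lipschitzOnWith.absolutelyContinuousOnInterval

theorem _root_.AbsolutelyContinuousOnInterval.inner {f g : ℝ → EuclideanSpace ℝ (Fin n)} {a b : ℝ}
    (hf : AbsolutelyContinuousOnInterval f a b) (hg : AbsolutelyContinuousOnInterval g a b) :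
    AbsolutelyContinuousOnInterval (fun s => inner ℝ (f s) (g s)) a b := by
  have hc : ∀ {u : ℝ → EuclideanSpace ℝ (Fin n)}, AbsolutelyContinuousOnInterval u a b → ∀ i : Fin n,
      AbsolutelyContinuousOnInterval (fun s => u s i) a b := fun hu i =>
    (EuclideanSpace.proj i : EuclideanSpace ℝ (Fin n) →L[ℝ] ℝ).lipschitz.comp_absolutelyContinuousOnInterval hu
  have hsum : ∀ S : Finset (Fin n),
      AbsolutelyContinuousOnInterval (fun s => ∑ i ∈ S, g s i * f s i) a b := by
    intro S
    induction S using Finset.induction_on with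
    | empty => simpa using AbsolutelyContinuousOnInterval.const (0 : ℝ) a b
    | insert i S hi ih =>
      simp only [Finset.sum_insert hi]
      exact ((hc hg i).mul (hc hf i)).add ih
  simpa [PiLp.inner_apply] using hsum Finset.univ

theorem ae_restrict_Icc_mono {P : ℝ → Prop} {a b c d : ℝ} (hac : a ≤ c) (hdb : d ≤ b)
    (h : ∀ᵐ s ∂(volume.restrict (Icc a b)), P s) : ∀ᵐ s ∂(volume.restrict (Icc c d)), P s :=
  ae_restrict_of_ae_restrict_of_subset (Icc_subset_Icc hac hdb) h

/-- A function on an interval with derivative bounded almost everywhere is Lipschitz as soon as it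
is absolutely continuous. -/
theorem norm_sub_le_of_ae_deriv_le {f : ℝ → EuclideanSpace ℝ (Fin n)} {a b M : ℝ} (hab : a ≤ b)
    (hf : AbsolutelyContinuousOnInterval f a b)
    (h : ∀ᵐ s ∂(volume.restrict (Icc a b)), ∃ v : EuclideanSpace ℝ (Fin n), HasDerivAt f v s ∧ ‖v‖ ≤ M) :
    ‖f b - f a‖ ≤ M * (b - a) := by
  set e := f b - f a with he
  have key := le_of_ae_deriv_nonneg (f := fun s => M * ‖e‖ * s - inner ℝ e (f s)) hab
    ((LipschitzWith.comp_absolutelyContinuousOnInterval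
        (g := fun s : ℝ => M * ‖e‖ * s)
        (ContinuousLinearMap.lipschitz ((M * ‖e‖) • ContinuousLinearMap.id ℝ ℝ))
        (f := fun s => s) LipschitzWith.id.lipschitzOnWith.absolutelyContinuousOnInterval).sub
      ((AbsolutelyContinuousOnInterval.const e a b).inner hf)) (by
      filter_upwards [h] with s ⟨v, hv, hM⟩
      refine ⟨M * ‖e‖ * 1 - inner ℝ e v, ?_, ?_⟩
      · exact ((hasDerivAt_id s).const_mul _).sub (by
          simpa using (hasDerivAt_const s e).inner ℝ hv)
      · nlinarith [real_inner_le_norm e v, norm_nonneg e])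
  have h2 : inner ℝ e (f b) - inner ℝ e (f a) = ‖e‖ ^ 2 := by
    rw [← inner_sub_right, ← he, real_inner_self_eq_norm_sq]
  have h3 : ‖e‖ ^ 2 ≤ M * ‖e‖ * (b - a) := by linarith
  rcases (norm_nonneg e).eq_or_lt with h0 | h0
  · rw [← h0] at *
    obtain rfl | hlt := hab.eq_or_lt
    · simp
    · have : ∃ s, ∃ v : EuclideanSpace ℝ (Fin n), HasDerivAt f v s ∧ ‖v‖ ≤ M := by
        have : NeBot (ae (volume.restrict (Icc a b))) := by
          rw [ae_restrict_neBot]; simp [hlt]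
        exact h.exists
      obtain ⟨s, v, -, hv⟩ := this
      exact mul_nonneg ((norm_nonneg v).trans hv) (by linarith)
  · nlinarith

/-- Gronwall's inequality, from below, for absolutely continuous functions. -/
theorem mul_exp_le_of_ae_deriv_ge {f : ℝ → ℝ} {a b k : ℝ} (hab : a ≤ b)
    (hf : AbsolutelyContinuousOnInterval f a b)
    (h : ∀ᵐ s ∂(volume.restrict (Icc a b)), ∃ v : ℝ, HasDerivAt f v s ∧ -k * f s ≤ v) :
    f a ≤ f b * Real.exp (k * (b - a)) := by
  have hexp : AbsolutelyContinuousOnInterval (fun s => Real.exp (k * (s - a))) a b :=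
    ContDiffOn.absolutelyContinuousOnInterval (by fun_prop)
  have key := le_of_ae_deriv_nonneg (f := fun s => f s * Real.exp (k * (s - a))) hab
    (hf.mul hexp) (by
      filter_upwards [h] with s ⟨v, hv, hM⟩
      have he : HasDerivAt (fun s => Real.exp (k * (s - a))) (Real.exp (k * (s - a)) * (k * 1)) s :=
        (((hasDerivAt_id s).sub_const a).const_mul k).exp
      refine ⟨_, hv.mul he, ?_⟩
      nlinarith [Real.exp_pos (k * (s - a))])
  simpa using key

end AbsoluteContinuity

section Hamiltonian

variable {n : ℕ}

variable {F : EuclideanSpace ℝ (Fin n) → Set (EuclideanSpace ℝ (Fin n))}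

theorem AssumptionF.bddAbove_inner (hF : AssumptionF F) (x p : EuclideanSpace ℝ (Fin n)) :
    BddAbove ((fun v => inner ℝ v p) '' F x) :=
  ((hF.isCompact x).image (by fun_prop)).bddAbove

theorem AssumptionF.inner_le_maxHamiltonian (hF : AssumptionF F) {x v : EuclideanSpace ℝ (Fin n)} (hv : v ∈ F x)
    (p : EuclideanSpace ℝ (Fin n)) : inner ℝ v p ≤ maxHamiltonian F x p :=
  le_csSup (hF.bddAbove_inner x p) (mem_image_of_mem _ hv)

theorem AssumptionF.exists_inner_eq_maxHamiltonian (hF : AssumptionF F) (x p : EuclideanSpace ℝ (Fin n)) :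
    ∃ v ∈ F x, inner ℝ v p = maxHamiltonian F x p :=
  ((hF.isCompact x).image (f := fun v => inner ℝ v p) (by fun_prop)).sSup_mem
    ((hF.nonempty x).image _)

theorem AssumptionF.maxHamiltonian_le (hF : AssumptionF F) {x p : EuclideanSpace ℝ (Fin n)} {M : ℝ}
    (h : ∀ v ∈ F x, inner ℝ v p ≤ M) : maxHamiltonian F x p ≤ M := by
  obtain ⟨v, hv, hvp⟩ := hF.exists_inner_eq_maxHamiltonian x p
  exact hvp ▸ h v hv

theorem maxHamiltonian_smul (x p : EuclideanSpace ℝ (Fin n)) {c : ℝ} (hc : 0 ≤ c) :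
    maxHamiltonian F x (c • p) = c * maxHamiltonian F x p := by
  rw [maxHamiltonian, maxHamiltonian, ← smul_eq_mul, ← Real.sSup_smul_of_nonneg hc]
  congr 1
  ext r
  simp [mem_smul_set, real_inner_smul_right]

theorem minHamiltonian_neg (x p : EuclideanSpace ℝ (Fin n)) :
    minHamiltonian F x (-p) = -maxHamiltonian F x p := by
  rw [minHamiltonian, maxHamiltonian, Real.sInf_def]
  congr 2
  ext r
  simp [neg_eq_iff_eq_neg]

theorem AssumptionF.exists_maxHamiltonian_lipschitz (hF : AssumptionF F) {C : Set (EuclideanSpace ℝ (Fin n))}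
    (hC : IsCompact C) : ∃ L : ℝ, 0 < L ∧ ∀ x ∈ C, ∀ y ∈ C, ∀ p,
      |maxHamiltonian F x p - maxHamiltonian F y p| ≤ L * ‖p‖ * ‖x - y‖ := by
  obtain ⟨L, hL, h⟩ := hF.locallyLipschitz C hC
  have key : ∀ x ∈ C, ∀ y ∈ C, ∀ p,
      maxHamiltonian F x p ≤ maxHamiltonian F y p + L * ‖p‖ * ‖x - y‖ := by
    intro x hx y hy p
    refine hF.maxHamiltonian_le fun v hv => ?_
    obtain ⟨u, hu, w, hw, rfl⟩ := mem_add.1 (h x hx y hy hv)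
    have hw' : ‖w‖ ≤ L * ‖x - y‖ := by rw [norm_sub_rev]; simpa using hw
    rw [inner_add_left]
    have h1 := hF.inner_le_maxHamiltonian hu p
    have h2 := real_inner_le_norm w p
    nlinarith [norm_nonneg p]
  refine ⟨L, hL, fun x hx y hy p => abs_sub_le_iff.2 ⟨?_, ?_⟩⟩
  · linarith [key x hx y hy p]
  · have := key y hy x hx p
    rw [norm_sub_rev] at this
    linarith

theorem AssumptionF.abs_maxHamiltonian_sub_le (hF : AssumptionF F) {x : EuclideanSpace ℝ (Fin n)} {M : ℝ}
    (hM : ∀ v ∈ F x, ‖v‖ ≤ M) (p q : EuclideanSpace ℝ (Fin n)) :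
    |maxHamiltonian F x p - maxHamiltonian F x q| ≤ M * ‖p - q‖ := by
  have key : ∀ p q : EuclideanSpace ℝ (Fin n), maxHamiltonian F x p ≤ maxHamiltonian F x q + M * ‖p - q‖ := by
    intro p q
    refine hF.maxHamiltonian_le fun v hv => ?_
    have h1 := hF.inner_le_maxHamiltonian hv q
    have h2 := real_inner_le_norm v (p - q)
    rw [inner_sub_right] at h2
    nlinarith [hM v hv, norm_nonneg (p - q)]
  refine abs_sub_le_iff.2 ⟨by linarith [key p q], ?_⟩
  have := key q p
  rw [norm_sub_rev] at this
  linarith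

/-- The maximized Hamiltonian is jointly continuous. -/
theorem AssumptionF.continuous_maxHamiltonian (hF : AssumptionF F) :
    Continuous fun z : EuclideanSpace ℝ (Fin n) × EuclideanSpace ℝ (Fin n) => maxHamiltonian F z.1 z.2 := by
  rw [continuous_iff_continuousAt]
  rintro ⟨x, p⟩
  obtain ⟨L, hL, h⟩ := hF.exists_maxHamiltonian_lipschitz (isCompact_closedBall x 1)
  obtain ⟨M, hM⟩ := (hF.isCompact x).isBounded.exists_norm_le
  have hlim : Tendsto (fun z : EuclideanSpace ℝ (Fin n) × EuclideanSpace ℝ (Fin n) => L * ‖z.2‖ * ‖z.1 - x‖ + M * ‖z.2 - p‖) (𝓝 (x, p))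
      (𝓝 0) := by
    have : Continuous fun z : EuclideanSpace ℝ (Fin n) × EuclideanSpace ℝ (Fin n) => L * ‖z.2‖ * ‖z.1 - x‖ + M * ‖z.2 - p‖ := by fun_prop
    simpa using this.tendsto (x, p)
  rw [ContinuousAt, tendsto_iff_norm_sub_tendsto_zero]
  refine squeeze_zero' (Eventually.of_forall fun _ => norm_nonneg _) ?_ hlim
  have hnear : ∀ᶠ z : EuclideanSpace ℝ (Fin n) × EuclideanSpace ℝ (Fin n) in 𝓝 (x, p), z.1 ∈ Metric.closedBall x 1 :=
    continuous_fst.continuousAt.eventually (Metric.closedBall_mem_nhds x one_pos)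
  filter_upwards [hnear] with z hz
  rw [Real.norm_eq_abs]
  have h1 := h z.1 hz x (Metric.mem_closedBall_self zero_le_one) z.2
  have h2 := hF.abs_maxHamiltonian_sub_le hM z.2 p
  have h3 := abs_sub_le (maxHamiltonian F z.1 z.2) (maxHamiltonian F x z.2) (maxHamiltonian F x p)
  linarith

/-- A maximizer is the gradient, where the gradient exists. -/
theorem AssumptionF.eq_gradient (hF : AssumptionF F) {x p v : EuclideanSpace ℝ (Fin n)}
    (hd : DifferentiableAt ℝ (maxHamiltonian F x) p) (hv : v ∈ F x)
    (hvp : inner ℝ v p = maxHamiltonian F x p) : v = gradient (maxHamiltonian F x) p := by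
  have hmin : IsLocalMin (fun q => maxHamiltonian F x q - inner ℝ v q) p :=
    Eventually.of_forall fun q => by
      have := hF.inner_le_maxHamiltonian hv q
      simp only; linarith
  have hder : HasFDerivAt (fun q => maxHamiltonian F x q - inner ℝ v q)
      (fderiv ℝ (maxHamiltonian F x) p - innerSL ℝ v) p :=
    hd.hasFDerivAt.sub (innerSL ℝ v).hasFDerivAt
  have h0 := hmin.hasFDerivAt_eq_zero hder
  refine ext_inner_right ℝ fun w => ?_
  rw [inner_gradient_left]
  have := congrArg (fun A : EuclideanSpace ℝ (Fin n) →L[ℝ] ℝ => A w) h0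
  simp at this
  linarith

theorem AssumptionF.gradient_mem (hF : AssumptionF F) {x p : EuclideanSpace ℝ (Fin n)}
    (hd : DifferentiableAt ℝ (maxHamiltonian F x) p) :
    gradient (maxHamiltonian F x) p ∈ F x ∧
      inner ℝ (gradient (maxHamiltonian F x) p) p = maxHamiltonian F x p := by
  obtain ⟨v, hv, hvp⟩ := hF.exists_inner_eq_maxHamiltonian x p
  rw [← hF.eq_gradient hd hv hvp]
  exact ⟨hv, hvp⟩

theorem AssumptionH.differentiableAt (hH : AssumptionH F) (x : EuclideanSpace ℝ (Fin n)) {p : EuclideanSpace ℝ (Fin n)} (hp : p ≠ 0) :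
    DifferentiableAt ℝ (maxHamiltonian F x) p :=
  hH.differentiable (‖x‖ + 1) (by positivity) x (by simp) p hp

theorem AssumptionH.continuousAt_gradient (hF : AssumptionF F) (hH : AssumptionH F) (x : EuclideanSpace ℝ (Fin n))
    {p : EuclideanSpace ℝ (Fin n)} (hp : p ≠ 0) : ContinuousAt (gradient (maxHamiltonian F x)) p := by
  have hne : ∀ᶠ q in 𝓝 p, q ≠ 0 := isOpen_ne.mem_nhds hp
  have hmem : ∀ᶠ q in 𝓝 p, gradient (maxHamiltonian F x) q ∈ F x :=
    hne.mono fun q hq => (hF.gradient_mem (hH.differentiableAt x hq)).1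
  obtain ⟨M, hM⟩ := (hF.isCompact x).isBounded.exists_norm_le
  have hlim : Tendsto (fun q => inner ℝ (gradient (maxHamiltonian F x) q) p) (𝓝 p)
      (𝓝 (maxHamiltonian F x p)) := by
    have h1 : Tendsto (fun q => (M + M) * ‖p - q‖) (𝓝 p) (𝓝 0) := by
      have : Continuous fun q : EuclideanSpace ℝ (Fin n) => (M + M) * ‖p - q‖ := by fun_prop
      simpa using this.tendsto p
    rw [tendsto_iff_norm_sub_tendsto_zero]
    refine squeeze_zero' (Eventually.of_forall fun _ => norm_nonneg _) ?_ h1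
    filter_upwards [hne] with q hq
    obtain ⟨hg, hgq⟩ := hF.gradient_mem (hH.differentiableAt x hq)
    have h2 := hF.abs_maxHamiltonian_sub_le hM q p
    have h3 : |inner ℝ (gradient (maxHamiltonian F x) q) (p - q)| ≤ M * ‖p - q‖ :=
      (abs_real_inner_le_norm _ _).trans (mul_le_mul_of_nonneg_right (hM _ hg) (norm_nonneg _))
    rw [inner_sub_right, hgq] at h3
    rw [norm_sub_rev] at h2
    rw [Real.norm_eq_abs]
    have h4 := abs_sub_le (inner ℝ (gradient (maxHamiltonian F x) q) p) (maxHamiltonian F x q)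
      (maxHamiltonian F x p)
    linarith
  refine (hF.isCompact x).tendsto_nhds_of_unique_mapClusterPt hmem fun v hv hcl => ?_
  have hcl2 : MapClusterPt (inner ℝ v p) (𝓝 p)
      (fun q => inner ℝ (gradient (maxHamiltonian F x) q) p) :=
    hcl.continuousAt_comp (f := fun w => inner ℝ w p) (by fun_prop)
  refine hF.eq_gradient (hH.differentiableAt x hp) hv ?_
  have : ClusterPt (inner ℝ v p) (𝓝 (maxHamiltonian F x p)) := ClusterPt.mono hcl2 hlim
  by_contra hne'
  exact (this.neBot).ne (disjoint_nhds_nhds.2 hne').eq_bot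

end Hamiltonian

section Semiconvexity

variable {E : Type*} [NormedAddCommGroup E] [InnerProductSpace ℝ E]

theorem SemiconvexOn.pow_mul_sub_le {Ω : Set E} (hΩ : Convex ℝ Ω) {c : ℝ} {f : E → ℝ}
    (hf : SemiconvexOn Ω c f) {y z : E} (hy : y ∈ Ω) (hz : z ∈ Ω) (k : ℕ) :
    (2 : ℝ) ^ k * (f (y + (1 / 2 : ℝ) ^ k • (z - y)) - f y) ≤
      f z - f y + c * ‖z - y‖ ^ 2 / 2 * (1 - (1 / 2) ^ k) := by
  have hline : ∀ s ∈ Icc (0 : ℝ) 1, y + s • (z - y) ∈ Ω := fun s hs =>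
    hΩ.add_smul_sub_mem hy hz hs
  induction k with
  | zero => simp
  | succ k ih =>
    set t : ℝ := (1 / 2) ^ k with ht
    have ht0 : 0 < t := by positivity
    have ht1 : t ≤ 1 := pow_le_one₀ (by norm_num) (by norm_num)
    have h2t : (2 : ℝ) ^ k * t = 1 := by rw [ht, ← mul_pow]; norm_num
    have hmid := hf.2 (y + (t / 2) • (z - y)) ((t / 2) • (z - y)) (by
      have e1 : y + (t / 2) • (z - y) - (t / 2) • (z - y) = y := by abel
      have e2 : y + (t / 2) • (z - y) + (t / 2) • (z - y) = y + t • (z - y) := by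
        rw [add_assoc, ← add_smul]; ring_nf
      rw [e1, e2]
      exact hΩ.segment_subset hy (hline t ⟨ht0.le, ht1⟩))
    have e1 : y + (t / 2) • (z - y) - (t / 2) • (z - y) = y := by abel
    have e2 : y + (t / 2) • (z - y) + (t / 2) • (z - y) = y + t • (z - y) := by
      rw [add_assoc, ← add_smul]; ring_nf
    rw [e1, e2, norm_smul, mul_pow, Real.norm_eq_abs, sq_abs] at hmid
    have e3 : (1 / 2 : ℝ) ^ (k + 1) = t / 2 := by rw [pow_succ]; ring
    rw [e3, pow_succ]
    have h5 := mul_le_mul_of_nonneg_left hmid (by positivity : (0 : ℝ) ≤ 2 ^ k)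
    have h6 : (2 : ℝ) ^ k * (c * ((t / 2) ^ 2 * ‖z - y‖ ^ 2)) = c * ‖z - y‖ ^ 2 * t / 4 := by
      linear_combination (c * ‖z - y‖ ^ 2 * t / 4) * h2t
    nlinarith

variable [CompleteSpace E]

theorem SemiconvexOn.inner_gradient_le {Ω : Set E} (hΩ : Convex ℝ Ω) {c : ℝ} {f : E → ℝ}
    (hf : SemiconvexOn Ω c f) {y z : E} (hy : y ∈ Ω) (hz : z ∈ Ω)
    (hd : DifferentiableAt ℝ f y) :
    inner ℝ (gradient f y) (z - y) ≤ f z - f y + c * ‖z - y‖ ^ 2 / 2 := by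
  have hder : HasDerivAt (fun s : ℝ => f (y + s • (z - y)))
      (inner ℝ (gradient f y) (z - y)) 0 := by
    have h1 : HasDerivAt (fun s : ℝ => y + s • (z - y)) (z - y) 0 := by
      simpa using ((hasDerivAt_id (0 : ℝ)).smul_const (z - y)).const_add y
    rw [inner_gradient_left]
    refine HasFDerivAt.comp_hasDerivAt (f := fun s : ℝ => y + s • (z - y)) (0 : ℝ) ?_ h1
    simpa using hd.hasFDerivAt
  have hpow : Tendsto (fun k : ℕ => (1 / 2 : ℝ) ^ k) atTop (𝓝 0) :=
    tendsto_pow_atTop_nhds_zero_of_lt_one (by norm_num) (by norm_num)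
  have hl := (hasDerivAt_iff_tendsto_slope_zero.1 hder).comp
    (tendsto_nhdsWithin_iff.2 ⟨hpow, Eventually.of_forall fun k =>
      (by positivity : (1 / 2 : ℝ) ^ k ≠ 0)⟩)
  have hr : Tendsto (fun k : ℕ => f z - f y + c * ‖z - y‖ ^ 2 / 2 * (1 - (1 / 2 : ℝ) ^ k)) atTop
      (𝓝 (f z - f y + c * ‖z - y‖ ^ 2 / 2 * (1 - 0))) :=
    ((hpow.const_sub 1).const_mul _).const_add _
  rw [sub_zero, mul_one] at hr
  refine le_of_tendsto_of_tendsto' hl hr fun k => ?_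
  have := hf.pow_mul_sub_le hΩ hy hz k
  simpa using this

theorem SemiconvexOn.inner_clarkeGradient_le {Ω : Set E} (hΩ : Convex ℝ Ω) (hΩ' : IsOpen Ω)
    {c : ℝ} {f : E → ℝ} (hf : SemiconvexOn Ω c f) {x z w : E} (hx : x ∈ Ω) (hz : z ∈ Ω)
    (hw : w ∈ clarkeGradient f x) :
    inner ℝ w (z - x) ≤ f z - f x + c * ‖z - x‖ ^ 2 / 2 := by
  have hconv : Convex ℝ {w : E | inner ℝ w (z - x) ≤ f z - f x + c * ‖z - x‖ ^ 2 / 2} :=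
    convex_halfSpace_le (f := fun w => inner ℝ w (z - x))
      ⟨fun a b => inner_add_left a b _, fun r a => real_inner_smul_left a _ r⟩ _
  refine convexHull_min ?_ hconv hw
  rintro v ⟨y, hd, hy, hv⟩
  have hfc : ContinuousAt f x := by
    simpa only [Pi.neg_def, neg_neg] using (hf.1.continuousAt (hΩ'.mem_nhds hx)).neg
  have hl : Tendsto (fun i => inner ℝ (gradient f (y i)) (z - y i)) atTop
      (𝓝 (inner ℝ v (z - x))) := hv.inner (hy.const_sub z)
  have hr : Tendsto (fun i => f z - f (y i) + c * ‖z - y i‖ ^ 2 / 2) atTop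
      (𝓝 (f z - f x + c * ‖z - x‖ ^ 2 / 2)) :=
    ((hfc.tendsto.comp hy).const_sub _).add
      (((((hy.const_sub z).norm).pow 2).const_mul c).div_const 2)
  refine le_of_tendsto_of_tendsto hl hr ?_
  filter_upwards [hy.eventually (hΩ'.mem_nhds hx)] with i hi
  exact hf.inner_gradient_le hΩ hi hz (hd i)

theorem norm_le_of_mem_clarkeGradient {Ω : Set E} (hΩ : IsOpen Ω) {C : NNReal} {f : E → ℝ}
    (hf : LipschitzOnWith C f Ω) {x w : E} (hx : x ∈ Ω) (hw : w ∈ clarkeGradient f x) :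
    ‖w‖ ≤ C := by
  suffices w ∈ Metric.closedBall (0 : E) C by simpa using this
  refine convexHull_min ?_ (convex_closedBall _ _) hw
  rintro v ⟨y, hd, hy, hv⟩
  refine Metric.isClosed_closedBall.mem_of_tendsto hv ?_
  filter_upwards [hy.eventually (hΩ.mem_nhds hx)] with i hi
  have h1 := norm_fderiv_le_of_lipschitzOn ℝ (hΩ.mem_nhds hi) hf
  rw [mem_closedBall_zero_iff, gradient, LinearIsometryEquiv.norm_map]
  exact h1

end Semiconvexity

section Proximal

variable {E : Type*} [NormedAddCommGroup E] [InnerProductSpace ℝ E]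

theorem mem_proximalSubdifferential_iff {f : E → EReal} {x v : E} {r : ℝ} (hr : f x = r) :
    v ∈ proximalSubdifferential f x ↔ ∃ σ : ℝ, 0 ≤ σ ∧ ∀ (y : E) (β : ℝ), f y ≤ β →
      inner ℝ v (y - x) - (β - r) ≤ σ * (‖y - x‖ ^ 2 + (β - r) ^ 2) := by
  have key : ∀ (y : E) (β σ : ℝ),
      (inner ℝ (WithLp.toLp 2 (v, (-1 : ℝ))) (WithLp.toLp 2 (y, β) - WithLp.toLp 2 (x, r)) ≤
        σ * ‖WithLp.toLp 2 (y, β) - WithLp.toLp 2 (x, r)‖ ^ 2) ↔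
      inner ℝ v (y - x) - (β - r) ≤ σ * (‖y - x‖ ^ 2 + (β - r) ^ 2) := by
    intro y β σ
    rw [WithLp.prod_inner_apply, WithLp.prod_norm_sq_eq_of_L2]
    simp [sub_eq_add_neg]
  constructor
  · rintro ⟨r', hr', -, σ, hσ, h⟩
    obtain rfl : r = r' := EReal.coe_injective (hr.symm.trans hr')
    exact ⟨σ, hσ, fun y β hy => (key y β σ).1 (h (WithLp.toLp 2 (y, β)) hy)⟩
  · rintro ⟨σ, hσ, h⟩
    refine ⟨r, hr, hr.le, σ, hσ, fun z hz => ?_⟩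
    exact (key z.fst z.snd σ).2 (h z.fst z.snd hz)

end Proximal

section Trajectories

variable {n : ℕ} {F : EuclideanSpace ℝ (Fin n) → Set (EuclideanSpace ℝ (Fin n))}
  {K : Set (EuclideanSpace ℝ (Fin n))}

theorem coe_ennreal_le_coe_iff {a : ℝ≥0∞} {β : ℝ} :
    (a : EReal) ≤ (β : EReal) ↔ 0 ≤ β ∧ a ≤ ENNReal.ofReal β := by
  constructor
  · intro h
    have hβ : 0 ≤ β := by
      have : ((0 : ℝ) : EReal) ≤ β := (EReal.coe_ennreal_nonneg a).trans h
      exact_mod_cast this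
    refine ⟨hβ, ?_⟩
    rw [← EReal.coe_ennreal_le_coe_ennreal_iff, EReal.coe_ennreal_ofReal, max_eq_left hβ]
    exact h
  · rintro ⟨hβ, h⟩
    rwa [← EReal.coe_ennreal_le_coe_ennreal_iff, EReal.coe_ennreal_ofReal, max_eq_left hβ] at h

theorem minTime_of_mem {x : EuclideanSpace ℝ (Fin n)} (h : x ∈ K) : minTime F K x = 0 := if_pos h

theorem minTime_le_of_trajectory {x₀ : EuclideanSpace ℝ (Fin n)} {τ : ℝ}
    {x : ℝ → EuclideanSpace ℝ (Fin n)} (hτ : 0 ≤ τ) (hx : IsTrajectory F x₀ τ x) (hK : x τ ∈ K) :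
    minTime F K x₀ ≤ ENNReal.ofReal τ := by
  by_cases h : x₀ ∈ K
  · simp [minTime_of_mem h]
  · have h0 : 0 < τ := hτ.lt_of_ne fun h0 => h (by rw [← hx.initial, h0]; exact hK)
    rw [minTime, if_neg h]
    exact sInf_le ⟨τ, ⟨h0, x, hx, hK⟩, rfl⟩

theorem IsTrajectory.exists_lipschitz (hF : AssumptionF F) {x₀ : EuclideanSpace ℝ (Fin n)} {τ : ℝ}
    {x : ℝ → EuclideanSpace ℝ (Fin n)} (hτ : 0 ≤ τ) (hx : IsTrajectory F x₀ τ x) :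
    ∃ M : NNReal, LipschitzOnWith M x (Icc 0 τ) := by
  obtain ⟨γ, hγ, hg⟩ := hF.linearGrowth
  obtain ⟨B, hB⟩ := hx.absolutelyContinuous.exists_bound
  rw [uIcc_of_le hτ] at hB
  have hB0 : 0 ≤ B := (norm_nonneg _).trans (hB 0 ⟨le_rfl, hτ⟩)
  have key : ∀ a ∈ Icc 0 τ, ∀ b ∈ Icc 0 τ, a ≤ b → ‖x b - x a‖ ≤ γ * (1 + B) * (b - a) := by
    intro a ha b hb hab
    refine norm_sub_le_of_ae_deriv_le hab (hx.absolutelyContinuous.mono ?_) ?_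
    · rw [uIcc_of_le hτ, uIcc_of_le hab]
      exact Icc_subset_Icc ha.1 hb.2
    · filter_upwards [ae_restrict_Icc_mono ha.1 hb.2 hx.inclusion,
        ae_restrict_mem measurableSet_Icc] with s ⟨v, hv, hd⟩ hs
      refine ⟨v, hd, (hg _ v hv).trans ?_⟩
      have := hB s ⟨ha.1.trans hs.1, hs.2.trans hb.2⟩
      gcongr
  refine ⟨(γ * (1 + B)).toNNReal, LipschitzOnWith.of_dist_le_mul fun a ha b hb => ?_⟩
  rw [dist_eq_norm, Real.dist_eq, Real.coe_toNNReal _ (by positivity)]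
  rcases le_total a b with h | h
  · rw [norm_sub_rev, abs_sub_comm, abs_of_nonneg (sub_nonneg.2 h)]
    exact key a ha b hb h
  · rw [abs_of_nonneg (sub_nonneg.2 h)]
    exact key b hb a ha h

theorem IsTrajectory.shift (hF : AssumptionF F) {x₀ : EuclideanSpace ℝ (Fin n)} {τ t : ℝ}
    {x : ℝ → EuclideanSpace ℝ (Fin n)} (hx : IsTrajectory F x₀ τ x) (ht : t ∈ Icc 0 τ) :
    IsTrajectory F (x t) (τ - t) (fun s => x (s + t)) := by
  obtain ⟨M, hM⟩ := hx.exists_lipschitz hF (ht.1.trans ht.2)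
  have hτt : 0 ≤ τ - t := sub_nonneg.2 ht.2
  have hmaps : MapsTo (fun s : ℝ => s + t) (Icc 0 (τ - t)) (Icc 0 τ) := fun s hs =>
    ⟨add_nonneg hs.1 ht.1, by linarith [hs.2]⟩
  refine ⟨?_, by simp, ?_⟩
  · refine LipschitzOnWith.absolutelyContinuousOnInterval (K := M) ?_
    rw [uIcc_of_le hτt]
    refine LipschitzOnWith.of_dist_le_mul fun a ha b hb => ?_
    simpa using hM.dist_le_mul _ (hmaps ha) _ (hmaps hb)
  · have h1 := (ae_restrict_iff' measurableSet_Icc).1 hx.inclusion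
    rw [ae_restrict_iff' measurableSet_Icc]
    filter_upwards [(measurePreserving_add_right volume t).quasiMeasurePreserving.ae h1]
      with s hs hsm
    obtain ⟨v, hv, hd⟩ := hs (hmaps hsm)
    exact ⟨v, hv, hd.comp_add_const s t⟩

/-- Concatenation of trajectories. -/
theorem IsTrajectory.concat (hF : AssumptionF F) {z : EuclideanSpace ℝ (Fin n)} {t τ : ℝ}
    {y u : ℝ → EuclideanSpace ℝ (Fin n)} (ht : 0 ≤ t) (hτ : 0 ≤ τ) (hy : IsTrajectory F z t y)
    (hu : IsTrajectory F (y t) τ u) :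
    IsTrajectory F z (t + τ) (fun s => if s ≤ t then y s else u (s - t)) := by
  obtain ⟨M, hM⟩ := hy.exists_lipschitz hF ht
  obtain ⟨N, hN⟩ := hu.exists_lipschitz hF hτ
  set w : ℝ → EuclideanSpace ℝ (Fin n) := fun s => if s ≤ t then y s else u (s - t) with hw
  have hwl : ∀ s, s ≤ t → w s = y s := fun s hs => if_pos hs
  have hwr : ∀ s, t ≤ s → w s = u (s - t) := by
    intro s hs
    rcases hs.eq_or_lt with rfl | hs
    · rw [hwl _ le_rfl, sub_self, hu.initial]
    · exact if_neg hs.not_ge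
  refine ⟨?_, by rw [hwl 0 ht, hy.initial], ?_⟩
  · refine LipschitzOnWith.absolutelyContinuousOnInterval (K := M + N) ?_
    rw [uIcc_of_le (add_nonneg ht hτ)]
    have key : ∀ a ∈ Icc 0 (t + τ), ∀ b ∈ Icc 0 (t + τ), a ≤ b →
        dist (w a) (w b) ≤ (M + N) * (b - a) := by
      intro a ha b hb hab
      have hl : ∀ a ∈ Icc 0 t, ∀ b ∈ Icc 0 t, a ≤ b → dist (w a) (w b) ≤ M * (b - a) := by
        intro a ha b hb hab
        rw [hwl a ha.2, hwl b hb.2]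
        refine (hM.dist_le_mul a ha b hb).trans_eq ?_
        rw [dist_comm, Real.dist_eq, abs_of_nonneg (sub_nonneg.2 hab)]
      have hr : ∀ a ∈ Icc t (t + τ), ∀ b ∈ Icc t (t + τ), a ≤ b →
          dist (w a) (w b) ≤ N * (b - a) := by
        intro a ha b hb hab
        rw [hwr a ha.1, hwr b hb.1]
        refine (hN.dist_le_mul (a - t) ⟨by linarith [ha.1], by linarith [ha.2]⟩ (b - t)
          ⟨by linarith [hb.1], by linarith [hb.2]⟩).trans_eq ?_
        rw [dist_sub_right, dist_comm, Real.dist_eq, abs_of_nonneg (sub_nonneg.2 hab)]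
      have hM0 := M.2
      have hN0 := N.2
      rcases le_total b t with h1 | h1
      · have := hl a ⟨ha.1, hab.trans h1⟩ b ⟨hb.1, h1⟩ hab
        nlinarith
      · rcases le_total t a with h2 | h2
        · have := hr a ⟨h2, ha.2⟩ b ⟨h1, hb.2⟩ hab
          nlinarith
        · have e1 := hl a ⟨ha.1, h2⟩ t ⟨ht, le_rfl⟩ h2
          have e2 := hr t ⟨le_rfl, by linarith⟩ b ⟨h1, hb.2⟩ h1
          have e3 := dist_triangle (w a) (w t) (w b)
          nlinarith
    refine LipschitzOnWith.of_dist_le_mul fun a ha b hb => ?_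
    rw [Real.dist_eq, NNReal.coe_add]
    rcases le_total a b with h | h
    · rw [abs_sub_comm, abs_of_nonneg (sub_nonneg.2 h)]
      exact key a ha b hb h
    · rw [abs_of_nonneg (sub_nonneg.2 h), dist_comm]
      exact key b hb a ha h
  · have h1 := (ae_restrict_iff' measurableSet_Icc).1 hy.inclusion
    have h2 := (measurePreserving_sub_right volume t).quasiMeasurePreserving.ae
      ((ae_restrict_iff' measurableSet_Icc).1 hu.inclusion)
    rw [ae_restrict_iff' measurableSet_Icc]
    filter_upwards [h1, h2, Measure.ae_ne volume t] with s hs1 hs2 hst hsm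
    rcases lt_or_gt_of_ne hst with h | h
    · obtain ⟨v, hv, hd⟩ := hs1 ⟨hsm.1, h.le⟩
      refine ⟨v, by rwa [hwl s h.le], hd.congr_of_eventuallyEq ?_⟩
      filter_upwards [Iio_mem_nhds h] with r hr using hwl r hr.le
    · obtain ⟨v, hv, hd⟩ := hs2 ⟨by linarith, by linarith [hsm.2]⟩
      refine ⟨v, by rwa [hwr s h.le], (hd.comp_sub_const s t).congr_of_eventuallyEq ?_⟩
      filter_upwards [Ioi_mem_nhds h] with r hr using hwr r hr.le

/-- The dynamic programming inequality. -/
theorem minTime_le_add (hF : AssumptionF F) {z : EuclideanSpace ℝ (Fin n)} {t : ℝ}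
    {y : ℝ → EuclideanSpace ℝ (Fin n)} (ht : 0 ≤ t) (hy : IsTrajectory F z t y) :
    minTime F K z ≤ ENNReal.ofReal t + minTime F K (y t) := by
  by_cases h : y t ∈ K
  · rw [minTime_of_mem h, add_zero]
    exact minTime_le_of_trajectory ht hy h
  · conv_rhs => rw [minTime, if_neg h, ENNReal.add_sInf]
    refine le_iInf₂ ?_
    rintro - ⟨τ, ⟨hτ, u, hu, huK⟩, rfl⟩
    rw [← ENNReal.ofReal_add ht hτ.le]
    refine minTime_le_of_trajectory (by positivity) (hy.concat hF ht hτ.le hu) ?_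
    simpa [hτ.not_ge] using huK

theorem IsTrajectory.restrict {x₀ : EuclideanSpace ℝ (Fin n)} {τ t : ℝ}
    {x : ℝ → EuclideanSpace ℝ (Fin n)} (hx : IsTrajectory F x₀ τ x) (ht : t ∈ Icc 0 τ) :
    IsTrajectory F x₀ t x :=
  ⟨hx.absolutelyContinuous.mono (by
    rw [uIcc_of_le ht.1, uIcc_of_le (ht.1.trans ht.2)]; exact Icc_subset_Icc le_rfl ht.2),
    hx.initial, ae_restrict_Icc_mono le_rfl ht.2 hx.inclusion⟩

/-- The minimum time decreases at unit rate along an optimal trajectory. -/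
theorem IsOptimalTrajectory.minTime_eq (hF : AssumptionF F) {x₀ : EuclideanSpace ℝ (Fin n)}
    {x : ℝ → EuclideanSpace ℝ (Fin n)} (hx : IsOptimalTrajectory F K x₀ x) {t : ℝ}
    (ht : t ∈ Icc 0 (minTime F K x₀).toReal) :
    minTime F K (x t) = ENNReal.ofReal ((minTime F K x₀).toReal - t) := by
  obtain ⟨hfin, htraj, hK⟩ := hx
  refine le_antisymm ?_ ?_
  · refine minTime_le_of_trajectory (sub_nonneg.2 ht.2) (htraj.shift hF ht) ?_
    simpa using hK
  · have := minTime_le_add (K := K) hF ht.1 (htraj.restrict ht)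
    rw [ENNReal.ofReal_sub _ ht.1, ENNReal.ofReal_toReal hfin]
    exact tsub_le_iff_left.2 this

theorem IsOptimalTrajectory.coe_minTime_eq (hF : AssumptionF F) {x₀ : EuclideanSpace ℝ (Fin n)}
    {x : ℝ → EuclideanSpace ℝ (Fin n)} (hx : IsOptimalTrajectory F K x₀ x) {t : ℝ}
    (ht : t ∈ Icc 0 (minTime F K x₀).toReal) :
    ((minTime F K (x t) : ℝ≥0∞) : EReal) = (((minTime F K x₀).toReal - t : ℝ) : EReal) := by
  rw [hx.minTime_eq hF ht, EReal.coe_ennreal_ofReal, max_eq_left (sub_nonneg.2 ht.2)]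

end Trajectories

section Flow

/-- The metric projection onto a closed convex set. -/
theorem exists_lipschitz_projection {E : Type*} [NormedAddCommGroup E] [InnerProductSpace ℝ E]
    [CompleteSpace E] {K : Set E} (hne : K.Nonempty) (hK : IsClosed K) (hconv : Convex ℝ K) :
    ∃ P : E → E, LipschitzWith 1 P ∧ (∀ x, P x ∈ K) ∧ ∀ x ∈ K, P x = x := by
  have h : ∀ x : E, ∃ v ∈ K, ∀ w ∈ K, inner ℝ (x - v) (w - v) ≤ 0 := fun x => by
    obtain ⟨v, hv, hxv⟩ := exists_norm_eq_iInf_of_complete_convex hne hK.isComplete hconv x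
    exact ⟨v, hv, (norm_eq_iInf_iff_real_inner_le_zero hconv hv).1 hxv⟩
  choose P hPK hP using h
  refine ⟨P, LipschitzWith.of_dist_le_mul fun x y => ?_, hPK, fun x hx => ?_⟩
  · have h1 := hP x (P y) (hPK y)
    have h2 := hP y (P x) (hPK x)
    have h3 : inner ℝ (x - y) (P x - P y) =
        ‖P x - P y‖ ^ 2 - inner ℝ (x - P x) (P y - P x) - inner ℝ (y - P y) (P x - P y) := by
      rw [← real_inner_self_eq_norm_sq]
      simp only [inner_sub_left, inner_sub_right]
      ring
    have h4 := real_inner_le_norm (x - y) (P x - P y)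
    rw [dist_eq_norm, dist_eq_norm, NNReal.coe_one, one_mul]
    by_contra! hlt
    nlinarith [norm_nonneg (x - y)]
  · have h1 := hP x x hx
    rw [real_inner_self_eq_norm_sq] at h1
    have h2 : ‖x - P x‖ = 0 := by nlinarith [norm_nonneg (x - P x)]
    exact (sub_eq_zero.1 (norm_eq_zero.1 h2)).symm

/-- A bounded, globally Lipschitz, time dependent vector field has a solution with prescribed
terminal value. -/
theorem exists_solution_terminal {E : Type*} [NormedAddCommGroup E] [NormedSpace ℝ E]
    [CompleteSpace E] {f : ℝ → E → E} {t : ℝ} (ht : 0 ≤ t) {L M : NNReal}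
    (hL : ∀ s ∈ Icc 0 t, LipschitzWith L (f s)) (hc : ∀ y, ContinuousOn (fun s => f s y) (Icc 0 t))
    (hM : ∀ s ∈ Icc 0 t, ∀ y, ‖f s y‖ ≤ M) (y : E) :
    ∃ α : ℝ → E, α t = y ∧ ∀ s ∈ Icc 0 t, HasDerivWithinAt α (f s (α s)) (Icc 0 t) s := by
  have hPL : IsPicardLindelof f (tmin := 0) (tmax := t) ⟨t, ht, le_rfl⟩ y (M * t.toNNReal) 0 M L :=
    { lipschitzOnWith := fun s hs => (hL s hs).lipschitzOnWith
      continuousOn := fun z _ => hc z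
      norm_le := fun s hs z _ => hM s hs z
      mul_max_le := by simp [ht] }
  exact hPL.exists_eq_forall_mem_Icc_hasDerivWithinAt₀

end Flow

section DualArc

variable {n : ℕ} {F : EuclideanSpace ℝ (Fin n) → Set (EuclideanSpace ℝ (Fin n))}

theorem AssumptionH.semiconvexOn (hH : AssumptionH F) {r : ℝ} (hr : 0 < r) :
    ∃ c : ℝ, 0 ≤ c ∧ ∀ p : EuclideanSpace ℝ (Fin n), p ≠ 0 →
      SemiconvexOn (Metric.ball 0 r) (c * ‖p‖) (fun x => maxHamiltonian F x p) := by
  obtain ⟨c, hc, h⟩ := hH.semiconvex r hr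
  refine ⟨c, hc, fun p hp => ?_⟩
  have hp' : 0 < ‖p‖ := norm_pos_iff.2 hp
  have heq : ∀ x, maxHamiltonian F x p = ‖p‖ * maxHamiltonian F x (‖p‖⁻¹ • p) := fun x => by
    rw [← maxHamiltonian_smul x _ hp'.le, smul_inv_smul₀ hp'.ne']
  obtain ⟨h1, h2⟩ := h (‖p‖⁻¹ • p) (norm_smul_inv_norm hp)
  simp only [SemiconvexOn, SemiconcaveOn, heq]
  refine ⟨?_, fun x k hk => ?_⟩
  · simpa using h1.const_mul ‖p‖
  · have := mul_le_mul_of_nonneg_left (h2 x k hk) hp'.le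
    linarith

theorem AssumptionF.exists_norm_clarkeGradient_le (hF : AssumptionF F) (r : ℝ) :
    ∃ L : ℝ, 0 ≤ L ∧ ∀ x ∈ Metric.ball (0 : EuclideanSpace ℝ (Fin n)) r, ∀ p,
      ∀ w ∈ clarkeGradient (fun y => maxHamiltonian F y p) x, ‖w‖ ≤ L * ‖p‖ := by
  obtain ⟨L, hL, h⟩ := hF.exists_maxHamiltonian_lipschitz
    (isCompact_closedBall (0 : EuclideanSpace ℝ (Fin n)) r)
  refine ⟨L, hL.le, fun x hx p w hw => ?_⟩
  have hlip : LipschitzOnWith (L * ‖p‖).toNNReal (fun y => maxHamiltonian F y p)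
      (Metric.ball 0 r) := LipschitzOnWith.of_dist_le_mul fun y hy z hz => by
    rw [Real.coe_toNNReal _ (by positivity), dist_eq_norm y z]
    exact h y (Metric.ball_subset_closedBall hy) z (Metric.ball_subset_closedBall hz) p
  simpa [Real.coe_toNNReal _ (by positivity : 0 ≤ L * ‖p‖)] using
    norm_le_of_mem_clarkeGradient Metric.isOpen_ball hlip hx hw

/-- An adjoint arc which does not vanish initially never vanishes. -/
theorem SolvesHamiltonianInclusion.arc_ne_zero (hF : AssumptionF F) {τ : ℝ}
    {x p : ℝ → EuclideanSpace ℝ (Fin n)} (h : SolvesHamiltonianInclusion F τ x p)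
    (h0 : p 0 ≠ 0) {t : ℝ} (ht : t ∈ Icc 0 τ) : p t ≠ 0 := by
  have hτ : 0 ≤ τ := ht.1.trans ht.2
  obtain ⟨B, hB⟩ := h.absolutelyContinuous_state.exists_bound
  rw [uIcc_of_le hτ] at hB
  obtain ⟨L, hL, hw⟩ := hF.exists_norm_clarkeGradient_le (B + 1)
  have hp : AbsolutelyContinuousOnInterval p 0 t := h.absolutelyContinuous_arc.mono (by
    rw [uIcc_of_le ht.1, uIcc_of_le hτ]; exact Icc_subset_Icc le_rfl ht.2)
  have key := mul_exp_le_of_ae_deriv_ge (k := 2 * L) ht.1 (hp.inner hp) (by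
    filter_upwards [ae_restrict_Icc_mono le_rfl ht.2 h.adjoint_inclusion,
      ae_restrict_mem measurableSet_Icc] with s ⟨w, hd, hcl⟩ hs
    refine ⟨_, hd.inner ℝ hd, ?_⟩
    have h1 := hw (x s) (by
      have := hB s ⟨hs.1, hs.2.trans ht.2⟩
      rw [mem_ball_zero_iff]; linarith) (p s) _ hcl
    rw [norm_neg] at h1
    have h2 := neg_le_of_abs_le (abs_real_inner_le_norm (p s) w)
    rw [real_inner_comm (p s) w, real_inner_self_eq_norm_sq]
    nlinarith [norm_nonneg (p s)])
  intro hpt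
  rw [hpt, inner_zero_left, zero_mul, real_inner_self_eq_norm_sq] at key
  have : 0 < ‖p 0‖ := norm_pos_iff.2 h0
  nlinarith

/-- Every point near `x t` is reached at time `t` by a trajectory whose initial point and whose
pairing with the adjoint arc are controlled by the distance to `x t`. -/
theorem SolvesHamiltonianInclusion.exists_trajectory_to (hF : AssumptionF F) (hH : AssumptionH F)
    {τ : ℝ} {x p : ℝ → EuclideanSpace ℝ (Fin n)} (h : SolvesHamiltonianInclusion F τ x p)
    (hp0 : ∀ s ∈ Icc 0 τ, p s ≠ 0) {t : ℝ} (ht : t ∈ Icc 0 τ) :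
    ∃ δ : ℝ, 0 < δ ∧ ∃ C : ℝ, 0 ≤ C ∧ ∀ y, ‖y - x t‖ ≤ δ →
      ∃ α : ℝ → EuclideanSpace ℝ (Fin n), IsTrajectory F (α 0) t α ∧ α t = y ∧
        ‖α 0 - x 0‖ ≤ C * ‖y - x t‖ ∧
        inner ℝ (p 0) (α 0 - x 0) ≤ inner ℝ (p t) (y - x t) + C * ‖y - x t‖ ^ 2 := by
  have hτ : 0 ≤ τ := ht.1.trans ht.2
  have hsub : Icc 0 t ⊆ Icc 0 τ := Icc_subset_Icc le_rfl ht.2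
  obtain ⟨B, hB⟩ := h.absolutelyContinuous_state.exists_bound
  obtain ⟨Q, hQ⟩ := h.absolutelyContinuous_arc.exists_bound
  have hpc := h.absolutelyContinuous_arc.continuousOn
  rw [uIcc_of_le hτ] at hB hQ hpc
  have hB0 : 0 ≤ B := (norm_nonneg _).trans (hB 0 ⟨le_rfl, hτ⟩)
  have hQ0 : 0 ≤ Q := (norm_nonneg _).trans (hQ 0 ⟨le_rfl, hτ⟩)
  set R : ℝ := B + 1 with hR
  have hR0 : 0 < R := by positivity
  have hball : Metric.closedBall (0 : EuclideanSpace ℝ (Fin n)) R ⊆ Metric.ball 0 (R + 1) :=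
    Metric.closedBall_subset_ball (by linarith)
  obtain ⟨L, hL, hgrad⟩ := hH.gradientLipschitz (R + 1) (by positivity)
  obtain ⟨c, hc, hsc⟩ := hH.semiconvexOn (r := R + 1) (by positivity)
  obtain ⟨γ, hγ, hg⟩ := hF.linearGrowth
  obtain ⟨P, hPlip, hPmem, hPid⟩ := exists_lipschitz_projection
    (K := Metric.closedBall (0 : EuclideanSpace ℝ (Fin n)) R) ⟨0, by simp [hR0.le]⟩
    Metric.isClosed_closedBall (convex_closedBall _ _)
  set f : ℝ → EuclideanSpace ℝ (Fin n) → EuclideanSpace ℝ (Fin n) :=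
    fun s y => gradient (maxHamiltonian F (P y)) (p s) with hf
  have hfmem : ∀ s ∈ Icc 0 τ, ∀ y, f s y ∈ F (P y) := fun s hs y =>
    (hF.gradient_mem (hH.differentiableAt (P y) (hp0 s hs))).1
  have hfL : ∀ s ∈ Icc 0 τ, ∀ y z, ‖f s y - f s z‖ ≤ L * ‖y - z‖ := fun s hs y z => by
    refine (hgrad (p s) (hp0 s hs) _ (hball (hPmem y)) _ (hball (hPmem z))).trans ?_
    have := hPlip.dist_le_mul y z
    rw [NNReal.coe_one, one_mul, dist_eq_norm, dist_eq_norm] at this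
    gcongr
  have hfM : ∀ s ∈ Icc 0 τ, ∀ y, ‖f s y‖ ≤ γ * (1 + R) := fun s hs y => by
    refine (hg _ _ (hfmem s hs y)).trans ?_
    have : ‖P y‖ ≤ R := by simpa using hPmem y
    gcongr
  have hxP : ∀ s ∈ Icc 0 τ, P (x s) = x s := fun s hs => hPid _ (by
    rw [mem_closedBall_zero_iff]; linarith [hB s hs])
  set G : ℝ := Real.exp (L * t) with hG
  have hG0 : 0 < G := Real.exp_pos _
  refine ⟨1 / G, by positivity, G + c * Q / 2 * G ^ 2 * t, by
    have := ht.1; positivity, fun y hy => ?_⟩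
  have hM0 : 0 ≤ γ * (1 + R) := by positivity
  obtain ⟨α, hαt, hα⟩ := exists_solution_terminal (f := f) ht.1 (L := L.toNNReal)
    (M := (γ * (1 + R)).toNNReal)
    (fun s hs => LipschitzWith.of_dist_le_mul fun y z => by
      rw [Real.coe_toNNReal _ hL, dist_eq_norm, dist_eq_norm]
      exact hfL s (hsub hs) y z)
    (fun z s hs => ContinuousAt.comp_continuousWithinAt (f := p)
      (g := gradient (maxHamiltonian F (P z)))
      (hH.continuousAt_gradient hF (P z) (hp0 s (hsub hs))) ((hpc s (hsub hs)).mono hsub))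
    (fun s hs z => by
      rw [Real.coe_toNNReal _ hM0]
      exact hfM s (hsub hs) z) y
  have hαac : AbsolutelyContinuousOnInterval α 0 t := by
    refine LipschitzOnWith.absolutelyContinuousOnInterval (K := (γ * (1 + R)).toNNReal) ?_
    rw [uIcc_of_le ht.1]
    refine (convex_Icc 0 t).lipschitzOnWith_of_nnnorm_hasDerivWithin_le hα fun s hs => ?_
    rw [← NNReal.coe_le_coe, coe_nnnorm, Real.coe_toNNReal _ hM0]
    exact hfM s (hsub hs) _
  have hxac : AbsolutelyContinuousOnInterval x 0 t := h.absolutelyContinuous_state.mono (by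
    rwa [uIcc_of_le ht.1, uIcc_of_le hτ])
  have hpac : AbsolutelyContinuousOnInterval p 0 t := h.absolutelyContinuous_arc.mono (by
    rwa [uIcc_of_le ht.1, uIcc_of_le hτ])
  have hae : ∀ᵐ s ∂(volume.restrict (Icc 0 t)), s ∈ Icc 0 t ∧ HasDerivAt α (f s (α s)) s ∧
      HasDerivAt x (f s (x s)) s ∧ ∃ w, HasDerivAt p w s ∧
        -w ∈ clarkeGradient (fun y => maxHamiltonian F y (p s)) (x s) := by
    filter_upwards [ae_restrict_Icc_mono le_rfl ht.2 h.state_equation,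
      ae_restrict_Icc_mono le_rfl ht.2 h.adjoint_inclusion, ae_restrict_mem measurableSet_Icc,
      ae_restrict_of_ae (Measure.ae_ne volume 0), ae_restrict_of_ae (Measure.ae_ne volume t)]
      with s ⟨v, hv, hd⟩ hw hs hs0 hst
    refine ⟨hs, (hα s hs).hasDerivAt (Icc_mem_nhds (hs.1.lt_of_ne hs0.symm) (hs.2.lt_of_ne hst)),
      ?_, hw⟩
    rw [← hv.gradient] at hd
    simpa only [hf, hxP s (hsub hs)] using hd
  have hgron : ∀ a ∈ Icc 0 t, ‖α a - x a‖ ≤ G * ‖y - x t‖ := by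
    intro a ha
    have hd : AbsolutelyContinuousOnInterval (α - x) a t := (hαac.sub hxac).mono (by
      rw [uIcc_of_le ha.2, uIcc_of_le ht.1]; exact Icc_subset_Icc ha.1 le_rfl)
    have key := mul_exp_le_of_ae_deriv_ge (k := 2 * L) ha.2 (hd.inner hd) (by
      filter_upwards [ae_restrict_Icc_mono ha.1 le_rfl hae] with s ⟨hs, h1, h2, _⟩
      refine ⟨_, (h1.sub h2).inner ℝ (h1.sub h2), ?_⟩
      have h3 := neg_le_of_abs_le (abs_real_inner_le_norm (α s - x s) (f s (α s) - f s (x s)))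
      have h4 := hfL s (hsub hs) (α s) (x s)
      rw [real_inner_comm ((α - x) s) (f s (α s) - f s (x s)), Pi.sub_apply, real_inner_self_eq_norm_sq]
      nlinarith [norm_nonneg (α s - x s)])
    simp only [Pi.sub_apply, real_inner_self_eq_norm_sq, hαt] at key
    have h5 : Real.exp (2 * L * (t - a)) ≤ G ^ 2 := by
      rw [hG, ← Real.exp_nat_mul]
      apply Real.exp_le_exp.2
      push_cast
      nlinarith [ha.1]
    refine abs_le_of_sq_le_sq' ?_ (by positivity) |>.2
    calc ‖α a - x a‖ ^ 2 ≤ ‖y - x t‖ ^ 2 * Real.exp (2 * L * (t - a)) := key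
      _ ≤ ‖y - x t‖ ^ 2 * G ^ 2 := by gcongr
      _ = (G * ‖y - x t‖) ^ 2 := by ring
  have hGy : G * ‖y - x t‖ ≤ 1 := by
    have := mul_le_mul_of_nonneg_left hy hG0.le
    rwa [mul_one_div_cancel hG0.ne'] at this
  have hαball : ∀ s ∈ Icc 0 t, α s ∈ Metric.closedBall (0 : EuclideanSpace ℝ (Fin n)) R := by
    intro s hs
    rw [mem_closedBall_zero_iff]
    have h1 := hgron s hs
    have h2 := hB s (hsub hs)
    have h3 := norm_add_le (α s - x s) (x s)
    rw [sub_add_cancel] at h3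
    linarith
  have hrest : 0 ≤ c * Q / 2 * G ^ 2 * t := by have := ht.1; positivity
  refine ⟨α, ⟨hαac, rfl, ?_⟩, hαt, ?_, ?_⟩
  · filter_upwards [hae] with s ⟨hs, h1, _⟩
    refine ⟨_, ?_, h1⟩
    have := hfmem s (hsub hs) (α s)
    rwa [hPid _ (hαball s hs)] at this
  · have := hgron 0 ⟨le_rfl, ht.1⟩
    nlinarith [norm_nonneg (y - x t)]
  · set D : ℝ := c * Q / 2 * (G * ‖y - x t‖) ^ 2 with hD
    have key := le_of_ae_deriv_nonneg
      (f := (fun s => inner ℝ (p s) ((α - x) s)) + fun s => D * s) ht.1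
      ((hpac.inner (hαac.sub hxac)).add (LipschitzOnWith.absolutelyContinuousOnInterval
        (ContinuousLinearMap.lipschitz (D • ContinuousLinearMap.id ℝ ℝ)).lipschitzOnWith)) (by
      filter_upwards [hae] with s ⟨hs, h1, h2, w, h3, h4⟩
      refine ⟨_, (h3.inner ℝ (h1.sub h2)).add ((hasDerivAt_id s).const_mul D), ?_⟩
      have hps := hp0 s (hsub hs)
      have e1 : inner ℝ (p s) (f s (α s)) = maxHamiltonian F (α s) (p s) := by
        have := (hF.gradient_mem (hH.differentiableAt (P (α s)) hps)).2
        rw [real_inner_comm]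
        refine this.trans ?_
        rw [hPid _ (hαball s hs)]
      have e2 : inner ℝ (p s) (f s (x s)) = maxHamiltonian F (x s) (p s) := by
        have := (hF.gradient_mem (hH.differentiableAt (P (x s)) hps)).2
        rw [real_inner_comm]
        refine this.trans ?_
        rw [hxP s (hsub hs)]
      have e3 := (hsc (p s) hps).inner_clarkeGradient_le (convex_ball _ _) Metric.isOpen_ball
        (hball (hxP s (hsub hs) ▸ hPmem _)) (hball (hαball s hs)) h4
      have e4 : c * ‖p s‖ * ‖α s - x s‖ ^ 2 / 2 ≤ D := by
        have := hQ s (hsub hs)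
        have := hgron s hs
        calc c * ‖p s‖ * ‖α s - x s‖ ^ 2 / 2 ≤ c * Q * (G * ‖y - x t‖) ^ 2 / 2 := by gcongr
          _ = D := by rw [hD]; ring
      rw [inner_sub_right, e1, e2, Pi.sub_apply]
      rw [inner_neg_left] at e3
      linarith)
    simp only [Pi.add_apply, Pi.sub_apply, hαt, mul_zero, add_zero] at key
    have e5 : D * t = c * Q / 2 * G ^ 2 * t * ‖y - x t‖ ^ 2 := by rw [hD]; ring
    nlinarith [sq_nonneg ‖y - x t‖]

end DualArc

section MainResult

variable {n : ℕ} {F : EuclideanSpace ℝ (Fin n) → Set (EuclideanSpace ℝ (Fin n))}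
  {K : Set (EuclideanSpace ℝ (Fin n))} {x₀ : EuclideanSpace ℝ (Fin n)}
  {x p : ℝ → EuclideanSpace ℝ (Fin n)}

theorem IsOptimalTrajectory.toReal_pos (hx : IsOptimalTrajectory F K x₀ x) (hx₀ : x₀ ∉ K) :
    0 < (minTime F K x₀).toReal := by
  refine ENNReal.toReal_nonneg.lt_of_ne fun h => hx₀ ?_
  have := hx.2.2
  rwa [← h, hx.2.1.initial] at this

/-- Zero is not a proximal subgradient of the minimum time at the initial point of an optimal
trajectory, off the target. -/
theorem IsOptimalTrajectory.zero_notMem_proximalSubdifferential (hF : AssumptionF F)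
    (hx : IsOptimalTrajectory F K x₀ x) (hx₀ : x₀ ∉ K) :
    (0 : EuclideanSpace ℝ (Fin n)) ∉
      proximalSubdifferential (fun y => ((minTime F K y : ℝ≥0∞) : EReal)) x₀ := by
  intro h0
  have hT := hx.toReal_pos hx₀
  set T := (minTime F K x₀).toReal with hTdef
  have hval := hx.coe_minTime_eq hF (t := 0) ⟨le_rfl, hT.le⟩
  rw [hx.2.1.initial, sub_zero] at hval
  obtain ⟨σ, hσ, h⟩ := (mem_proximalSubdifferential_iff
    (f := fun y => ((minTime F K y : ℝ≥0∞) : EReal)) hval).1 h0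
  obtain ⟨M, hM⟩ := hx.2.1.exists_lipschitz hF hT.le
  set A : ℝ := σ * ((M : ℝ) ^ 2 + 1) with hA
  have hA0 : 0 ≤ A := by positivity
  set s : ℝ := min T (1 / (A + 1)) with hs
  have hs0 : 0 < s := lt_min hT (by positivity)
  have hsT : s ≤ T := min_le_left _ _
  have hsA : s * (A + 1) ≤ 1 := by
    rw [← le_div_iff₀ (by positivity)]; exact min_le_right _ _
  have h1 := h (x s) (T - s) (hx.coe_minTime_eq hF ⟨hs0.le, hsT⟩).le
  have h2 : ‖x s - x₀‖ ≤ M * s := by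
    have := hM.dist_le_mul s ⟨hs0.le, hsT⟩ 0 ⟨le_rfl, hT.le⟩
    rwa [hx.2.1.initial, dist_eq_norm, Real.dist_eq, sub_zero, abs_of_pos hs0] at this
  have h3 : σ * (‖x s - x₀‖ ^ 2 + (T - s - T) ^ 2) ≤ σ * ((M * s) ^ 2 + s ^ 2) := by
    have : T - s - T = -s := by ring
    rw [this, neg_sq]
    gcongr
  have h4 : σ * ((M * s) ^ 2 + s ^ 2) = A * s * s := by rw [hA]; ring
  rw [inner_zero_left] at h1
  nlinarith

/-- Propagation of proximal subgradients of the minimum time along a dual arc. -/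
theorem IsOptimalTrajectory.neg_arc_mem_proximalSubdifferential (hF : AssumptionF F)
    (hH : AssumptionH F) (hx : IsOptimalTrajectory F K x₀ x)
    (hxp : SolvesHamiltonianInclusion F (minTime F K x₀).toReal x p)
    (hp0 : ∀ s ∈ Icc 0 (minTime F K x₀).toReal, p s ≠ 0)
    (hp : -p 0 ∈ proximalSubdifferential (fun y => ((minTime F K y : ℝ≥0∞) : EReal)) x₀)
    {t : ℝ} (ht : t ∈ Icc 0 (minTime F K x₀).toReal) :
    -p t ∈ proximalSubdifferential (fun y => ((minTime F K y : ℝ≥0∞) : EReal)) (x t) := by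
  set T := (minTime F K x₀).toReal with hTdef
  have hval := hx.coe_minTime_eq hF (t := 0) ⟨le_rfl, ht.1.trans ht.2⟩
  rw [hx.2.1.initial, sub_zero] at hval
  obtain ⟨σ, hσ, h⟩ := (mem_proximalSubdifferential_iff
    (f := fun y => ((minTime F K y : ℝ≥0∞) : EReal)) hval).1 hp
  obtain ⟨δ, hδ, C, hC, htraj⟩ := hxp.exists_trajectory_to hF hH hp0 ht
  rw [mem_proximalSubdifferential_iff
    (f := fun y => ((minTime F K y : ℝ≥0∞) : EReal))
    (hx.coe_minTime_eq hF ht)]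
  have hr : 0 ≤ T - t := sub_nonneg.2 ht.2
  refine ⟨(C + σ * C ^ 2 + σ) + (‖p t‖ / δ + (T - t) / δ ^ 2), by positivity, fun y β hy => ?_⟩
  obtain ⟨hβ, hyβ⟩ := coe_ennreal_le_coe_iff.1 hy
  have hd0 : 0 ≤ ‖y - x t‖ := norm_nonneg _
  set d := ‖y - x t‖ with hd
  set e := β - (T - t) with he
  rcases le_total d δ with hdδ | hdδ
  · obtain ⟨α, hα, hαt, hα0, hpair⟩ := htraj y hdδ
    have h1 : ((minTime F K (α 0) : ℝ≥0∞) : EReal) ≤ ((t + β : ℝ) : EReal) := by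
      refine coe_ennreal_le_coe_iff.2 ⟨add_nonneg ht.1 hβ, ?_⟩
      rw [ENNReal.ofReal_add ht.1 hβ]
      refine (minTime_le_add hF ht.1 hα).trans ?_
      rw [hαt]
      gcongr
    have h2 := h (α 0) (t + β) h1
    have h3 : t + β - (minTime F K x₀).toReal = e := by rw [he]; ring
    rw [← hx.2.1.initial, hx.2.1.initial, h3] at h2
    rw [hx.2.1.initial] at hα0 hpair
    have h4 : σ * (‖α 0 - x₀‖ ^ 2 + e ^ 2) ≤ σ * ((C * d) ^ 2 + e ^ 2) := by gcongr
    have h5 : 0 ≤ (‖p t‖ / δ + (T - t) / δ ^ 2) * (d ^ 2 + e ^ 2) := by positivity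
    have h6 : 0 ≤ (C + σ * C ^ 2) * e ^ 2 + σ * d ^ 2 := by positivity
    rw [inner_neg_left] at h2 ⊢
    nlinarith
  · have h1 := real_inner_le_norm (-p t) (y - x t)
    rw [norm_neg, ← hd] at h1
    have h2 : ‖p t‖ * d ≤ ‖p t‖ / δ * d ^ 2 := by
      rw [div_mul_eq_mul_div, le_div_iff₀ hδ]
      nlinarith [mul_nonneg (norm_nonneg (p t)) hd0]
    have h3 : T - t ≤ (T - t) / δ ^ 2 * d ^ 2 := by
      rw [div_mul_eq_mul_div, le_div_iff₀ (by positivity)]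
      gcongr
    have h4 : 0 ≤ (C + σ * C ^ 2 + σ) * (d ^ 2 + e ^ 2) := by positivity
    have h5 : 0 ≤ (‖p t‖ / δ + (T - t) / δ ^ 2) * e ^ 2 := by positivity
    nlinarith

/-- The Hamiltonian is constant, equal to one, along a dual arc of proximal subgradients. -/
theorem IsOptimalTrajectory.maxHamiltonian_eq_one (hF : AssumptionF F)
    (hx : IsOptimalTrajectory F K x₀ x) (hx₀ : x₀ ∉ K)
    (hxp : SolvesHamiltonianInclusion F (minTime F K x₀).toReal x p)
    (hp : ∀ t ∈ Icc 0 (minTime F K x₀).toReal,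
      -p t ∈ proximalSubdifferential (fun y => ((minTime F K y : ℝ≥0∞) : EReal)) (x t))
    {t : ℝ} (ht : t ∈ Icc 0 (minTime F K x₀).toReal) :
    maxHamiltonian F (x t) (p t) = 1 := by
  have hT := hx.toReal_pos hx₀
  set T := (minTime F K x₀).toReal with hTdef
  have hcont : ContinuousOn (fun s => maxHamiltonian F (x s) (p s)) (Icc 0 T) := by
    have h1 := hxp.absolutelyContinuous_state.continuousOn
    have h2 := hxp.absolutelyContinuous_arc.continuousOn
    rw [uIcc_of_le hT.le] at h1 h2
    exact hF.continuous_maxHamiltonian.comp_continuousOn (f := fun s => (x s, p s))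
      (h1.prodMk h2)
  have hae : ∀ᵐ s ∂(volume.restrict (Icc 0 T)), maxHamiltonian F (x s) (p s) = 1 := by
    filter_upwards [hxp.state_equation, ae_restrict_mem measurableSet_Icc,
      ae_restrict_of_ae (Measure.ae_ne volume 0), ae_restrict_of_ae (Measure.ae_ne volume T)]
      with s ⟨v, hv, hd⟩ hs hs0 hsT
    have hnhds : Icc 0 T ∈ 𝓝 s := Icc_mem_nhds (hs.1.lt_of_ne hs0.symm) (hs.2.lt_of_ne hsT)
    obtain ⟨σ, hσ, h⟩ := (mem_proximalSubdifferential_iff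
      (f := fun y => ((minTime F K y : ℝ≥0∞) : EReal))
      (hx.coe_minTime_eq hF hs)).1 (hp s hs)
    have hdiff : HasDerivAt (fun r => x r - x s) v s := hd.sub_const _
    have hlin : HasDerivAt (fun r : ℝ => r - s) 1 s := (hasDerivAt_id s).sub_const s
    have hder : HasDerivAt (fun r => σ * (inner ℝ (x r - x s) (x r - x s) + (r - s) ^ 2) +
        (inner ℝ (p s) (x r - x s) - (r - s))) (inner ℝ (p s) v - 1) s := by
      have h1 : HasDerivAt (fun r => inner ℝ (x r - x s) (x r - x s)) 0 s := by
        simpa using hdiff.inner ℝ hdiff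
      have h2 : HasDerivAt (fun r : ℝ => (r - s) ^ 2) 0 s := by simpa using hlin.fun_pow 2
      have h3 : HasDerivAt (fun r => inner ℝ (p s) (x r - x s)) (inner ℝ (p s) v) s := by
        simpa using (hasDerivAt_const s (p s)).inner ℝ hdiff
      simpa using ((h1.fun_add h2).const_mul σ).fun_add (h3.fun_sub hlin)
    have hmin : IsLocalMin (fun r => σ * (inner ℝ (x r - x s) (x r - x s) + (r - s) ^ 2) +
        (inner ℝ (p s) (x r - x s) - (r - s))) s := by
      filter_upwards [hnhds] with r hr
      have h1 := h (x r) (T - r) (hx.coe_minTime_eq hF hr).le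
      have h2 : T - r - (T - s) = -(r - s) := by ring
      rw [inner_neg_left, ← real_inner_self_eq_norm_sq, h2, neg_sq] at h1
      simp only [sub_self, inner_zero_right]
      linarith
    have hzero := hmin.hasDerivAt_eq_zero hder
    have hH1 := hF.gradient_mem hv.differentiableAt
    rw [hv.gradient, real_inner_comm] at hH1
    rw [← hH1.2]
    linarith
  have hset : EqOn (fun s => maxHamiltonian F (x s) (p s)) (fun _ => 1) (Icc 0 T) :=
    Measure.eqOn_Icc_of_ae_eq volume hT.ne hae hcont continuousOn_const
  exact hset ht

end MainResult

end MinTime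

end

theorem mainTheorem9 (n : ℕ)
    (F : EuclideanSpace ℝ (Fin n) → Set (EuclideanSpace ℝ (Fin n)))
    (hF : MinTime.AssumptionF F) (hH : MinTime.AssumptionH F)
    (K : Set (EuclideanSpace ℝ (Fin n))) (hK : IsClosed K)
    (x₀ : EuclideanSpace ℝ (Fin n)) (hx₀ : MinTime.minTime F K x₀ < ⊤) (hx₀K : x₀ ∉ K)
    (x p : ℝ → EuclideanSpace ℝ (Fin n))
    (hx : MinTime.IsOptimalTrajectory F K x₀ x)
    (hxp : MinTime.SolvesHamiltonianInclusion F (MinTime.minTime F K x₀).toReal x p)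
    (hp : -p 0 ∈ MinTime.proximalSubdifferential
      (fun y => ((MinTime.minTime F K y : ℝ≥0∞) : EReal)) x₀) :
    ∀ t ∈ Icc 0 (MinTime.minTime F K x₀).toReal,
      -p t ∈ MinTime.proximalSubdifferential
        (fun y => ((MinTime.minTime F K y : ℝ≥0∞) : EReal)) (x t) ∧
      MinTime.minHamiltonian F (x t) (-p t) = -1 := by
  have hp0 : p 0 ≠ 0 := fun h0 => hx.zero_notMem_proximalSubdifferential hF hx₀K (by
    rwa [h0, neg_zero] at hp)
  have hprox := fun t ht => hx.neg_arc_mem_proximalSubdifferential hF hH hxp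
    (fun s hs => hxp.arc_ne_zero hF hp0 hs) hp (t := t) ht
  intro t ht
  exact ⟨hprox t ht, by
    rw [MinTime.minHamiltonian_neg, hx.maxHamiltonian_eq_one hF hx₀K hxp hprox ht]⟩
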